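/- Let $m\in\mathbb N$ and, for $a=(a_1,\dots,a_m)\in\mathbb C^m$, let $W(X)=X^m+a_1X^{m-1}+\cdots+a_m$. Define $b_k(a)$ by the formal expansion $(1+a_1T+\cdots+a_mT^m)^{1/2}=1+\sum_{k\ge1}b_k(a)T^k$ and put $b_0=1$. Let $$S(X,a)=\sum_{0\le k<\frac{m+2}{2}}\frac{b_k(a)}{\frac{m+2}{2}-k}\,X^{\frac{m+2}{2}-k},\qquad r_m(a)=\begin{cases}-\frac m4, & m\text{ odd},\\ -\frac m4-b_{1+m/2}(a), & m\text{ even},\end{cases}$$ with principal branches of the powers of $X$. Let $\Phi_0(X,a)$ be the canonical (Sibuya) solution of $$-\Phi''(X)+W(X)\Phi(X)=0,$$ that is, the unique solution that is entire in $(X,a)\in\mathbb C\times\mathbb C^m$ and satisfies $$\Phi_0(X,a)=X^{r_m(a)}e^{-S(X,a)}\bigl[1+O(X^{-1/2})\bigr],\qquad \Phi_0'(X,a)=X^{\frac m2+r_m(a)}e^{-S(X,a)}\bigl[-1+O(X^{-1/2})\bigr]$$ as $X\to\infty$ in each sector $|\arg X|\le\theta$ with $\theta<\frac{3\pi}{m+2}$,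 uniformly for $a$ in compact subsets of $\mathbb C^m$. Let $\omega=e^{2\pi i/(m+2)}$, let $\omega^z=e^{2\pi i z/(m+2)}$ for $z\in\mathbb C$, let $\omega_k(a)=(\omega^ka_1,\omega^{2k}a_2,\dots,\omega^{mk}a_m)$ for $k\in\mathbb Z$, and let $$\Phi_1(X,a)=\omega^{-\frac m2-r_m(a)}\,\Phi_0(\omega^{-1}X,\omega_{-1}(a)),\qquad \Phi_{-1}(X,a)=\omega^{\frac m2+r_m(a)}\,\Phi_0(\omega X,\omega_1(a)).$$ Then there is exactly one function $C:\mathbb C^m\to\mathbb C$, the normalized Stokes multiplier of $\Phi_{-1}$ with respect to $\Phi_0$, such that $\Phi_{-1}(X,a)=C(a)\Phi_0(X,a)+\Phi_1(X,a)$ for all $X\in\mathbb C$ and $a\in\mathbb C^m$. For every $a\in\mathbb C^m$ it satisfies $$\overline{C(a)}+C(\overline a)=0.$$ Consequently the zero set of $C$ is invariant under the complex conjugation $a\mapsto\overline a$, and $-iC(a)$ is real for every $a\in\mathbb R^m$. -/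

import Mathlib

open scoped ComplexConjugate

noncomputable section

namespace StokesODE

/-- The monic polynomial `W(X) = X^m + a₁ X^(m-1) + ⋯ + a_m`, where the entry `a j` of the
vector `a : Fin m → ℂ` is the coefficient `a_(j+1)`. -/
def W {m : ℕ} (a : Fin m → ℂ) (X : ℂ) : ℂ :=
  X ^ m + ∑ j : Fin m, a j * X ^ (m - 1 - (j : ℕ))

/-- The coefficients `b_k(a)` of the formal square root
`(1 + a₁ T + ⋯ + a_m T^m)^(1/2) = 1 + ∑_{k ≥ 1} b_k(a) T^k`, with `b_0 = 1`; the recursion is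
`2 b_(k+1) = a_(k+1) - ∑_{i+j = k+1, i,j ≥ 1} b_i b_j`. -/
def sqrtCoeff {m : ℕ} (a : Fin m → ℂ) : ℕ → ℂ
  | 0 => 1
  | k + 1 =>
    ((if h : k < m then a ⟨k, h⟩ else 0)
      - ∑ i : Fin k, sqrtCoeff a ((i : ℕ) + 1) * sqrtCoeff a (k - (i : ℕ))) / 2
termination_by k => k
decreasing_by
  all_goals omega

/-- The `b_k(a)` are indeed the coefficients of the square root of `1 + a₁ T + ⋯ + a_m T^m`. -/
theorem mk_sqrtCoeff_sq {m : ℕ} (a : Fin m → ℂ) :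
    (PowerSeries.mk (sqrtCoeff a)) ^ 2
      = 1 + ∑ j : Fin m, PowerSeries.C (a j) * PowerSeries.X ^ ((j : ℕ) + 1) := by
  ext n
  rw [sq, PowerSeries.coeff_mul]
  simp only [PowerSeries.coeff_mk, map_add, map_sum, PowerSeries.coeff_C_mul,
    PowerSeries.coeff_X_pow, PowerSeries.coeff_one]
  rcases n with _ | n
  · simp [sqrtCoeff]
  · rw [Finset.Nat.sum_antidiagonal_eq_sum_range_succ (fun i j => sqrtCoeff a i * sqrtCoeff a j),
      Finset.sum_range_succ, Finset.sum_range_succ']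
    have h1 : ∑ j : Fin m, a j * (if n + 1 = (j : ℕ) + 1 then (1 : ℂ) else 0)
        = if h : n < m then a ⟨n, h⟩ else 0 := by
      split_ifs with h
      · rw [Finset.sum_eq_single ⟨n, h⟩]
        · simp
        · intro b _ hb
          rw [if_neg, mul_zero]
          intro h'
          exact hb (Fin.ext (by simp; omega))
        · simp
      · refine Finset.sum_eq_zero fun j _ => ?_
        rw [if_neg (by have := j.2; omega), mul_zero]
    have h2 : ∑ k ∈ Finset.range n, sqrtCoeff a (k + 1) * sqrtCoeff a (n + 1 - (k + 1))
        = ∑ i : Fin n, sqrtCoeff a ((i : ℕ) + 1) * sqrtCoeff a (n - (i : ℕ)) := by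
      rw [Finset.sum_range]
      simp
    rw [h1, h2]
    have h3 : sqrtCoeff a (n + 1) = ((if h : n < m then a ⟨n, h⟩ else 0)
      - ∑ i : Fin n, sqrtCoeff a ((i : ℕ) + 1) * sqrtCoeff a (n - (i : ℕ))) / 2 := by
      rw [sqrtCoeff]
    have h0 : sqrtCoeff a 0 = 1 := by rw [sqrtCoeff]
    rw [h3]
    simp [h0, -dite_eq_ite]
    rw [h3]
    ring

/-- The exponent `r_m(a)`: `-m/4` for odd `m`, and `-m/4 - b_(1+m/2)(a)` for even `m`. -/
def r {m : ℕ} (a : Fin m → ℂ) : ℂ :=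
  if Even m then -(m : ℂ) / 4 - sqrtCoeff a (1 + m / 2) else -(m : ℂ) / 4

/-- `S(X, a)`: the terms with strictly positive powers of `X` in the termwise primitive
`∑_k b_k(a) X^((m+2)/2 - k) / ((m+2)/2 - k)` of `√W(X) = X^(m/2) ∑_k b_k(a) X^(-k)`
(principal branch of the powers). -/
def S {m : ℕ} (X : ℂ) (a : Fin m → ℂ) : ℂ :=
  ∑ k ∈ (Finset.range (m + 2)).filter (fun k => 2 * k < m + 2),
    sqrtCoeff a k * X ^ (((m : ℂ) + 2) / 2 - (k : ℂ)) / (((m : ℂ) + 2) / 2 - (k : ℂ))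

/-- The defining properties of the canonical (Sibuya) solution `Φ₀(X, a)` of
`-Φ'' + W Φ = 0`. The asymptotic conditions hold as `X → ∞` in every closed subsector
`|arg X| ≤ θ`, `θ < 3π/(m+2)`, uniformly for `a` in compact subsets of `ℂ^m`. -/
structure IsCanonicalSolution (m : ℕ) (Φ₀ : ℂ → (Fin m → ℂ) → ℂ) : Prop where
  /-- `Φ₀` is entire in `(X, a₁, …, a_m)`. -/
  entire : Differentiable ℂ (fun p : ℂ × (Fin m → ℂ) => Φ₀ p.1 p.2)
  /-- `Φ₀(·, a)` solves the differential equation. -/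
  ode : ∀ (a : Fin m → ℂ) (X : ℂ),
    -deriv (deriv (fun Y => Φ₀ Y a)) X + W a X * Φ₀ X a = 0
  /-- `Φ₀ = X^(r_m) e^(-S) (1 + O(X^(-1/2)))`. -/
  asymp : ∀ K : Set (Fin m → ℂ), IsCompact K → ∀ θ : ℝ, θ < 3 * Real.pi / (m + 2) →
    ∃ M R : ℝ, 0 < R ∧ ∀ a ∈ K, ∀ X : ℂ, R ≤ ‖X‖ → |X.arg| ≤ θ →
      ‖Φ₀ X a / (X ^ r a * Complex.exp (-S X a)) - 1‖ ≤ M * ‖X‖ ^ (-(1 / 2) : ℝ)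
  /-- `Φ₀' = X^(m/2 + r_m) e^(-S) (-1 + O(X^(-1/2)))`. -/
  asymp_deriv : ∀ K : Set (Fin m → ℂ), IsCompact K → ∀ θ : ℝ, θ < 3 * Real.pi / (m + 2) →
    ∃ M R : ℝ, 0 < R ∧ ∀ a ∈ K, ∀ X : ℂ, R ≤ ‖X‖ → |X.arg| ≤ θ →
      ‖deriv (fun Y => Φ₀ Y a) X / (X ^ ((m : ℂ) / 2 + r a) * Complex.exp (-S X a)) - (-1)‖
        ≤ M * ‖X‖ ^ (-(1 / 2) : ℝ)

theorem tendsto_S_div {m : ℕ} (a : Fin m → ℂ) : Filter.Tendsto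
    (fun x : ℝ => S (x : ℂ) a / ((x : ℂ) ^ (((m : ℂ) + 2) / 2))) Filter.atTop
      (nhds (2 / ((m : ℂ) + 2))) := by
  have hm0 : ((m : ℂ) + 2) ≠ 0 := by exact_mod_cast (by omega : m + 2 ≠ 0)
  have key : ∀ k ∈ (Finset.range (m + 2)).filter (fun k => 2 * k < m + 2),
      Filter.Tendsto (fun x : ℝ => sqrtCoeff a k * ((x : ℂ) ^ k)⁻¹ / (((m : ℂ) + 2) / 2 - (k : ℂ)))
        Filter.atTop (nhds (if k = 0 then 2 / ((m : ℂ) + 2) else 0)) := by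
    intro k _
    by_cases hk : k = 0
    · subst hk
      have h0 : sqrtCoeff a 0 = 1 := by rw [sqrtCoeff]
      simp [h0]
    · rw [if_neg hk]
      have h1 : Filter.Tendsto (fun x : ℝ => ((x : ℂ) ^ k)⁻¹) Filter.atTop (nhds 0) := by
        rw [tendsto_zero_iff_norm_tendsto_zero]
        have := (tendsto_pow_neg_atTop (𝕜 := ℝ) hk).norm
        simpa using this
      simpa using (h1.const_mul (sqrtCoeff a k)).div_const (((m : ℂ) + 2) / 2 - (k : ℂ))
  have h2 := tendsto_finsetSum _ key
  have h3 : ∑ k ∈ (Finset.range (m + 2)).filter (fun k => 2 * k < m + 2),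
      (if k = 0 then 2 / ((m : ℂ) + 2) else 0) = 2 / ((m : ℂ) + 2) := by
    rw [Finset.sum_ite_eq' _ 0 (fun _ => 2 / ((m : ℂ) + 2)), if_pos (by simp)]
  rw [h3] at h2
  refine h2.congr' ?_
  filter_upwards [Filter.eventually_gt_atTop 0] with x hx
  have hx0 : (x : ℂ) ≠ 0 := by exact_mod_cast hx.ne'
  rw [S, Finset.sum_div]
  refine Finset.sum_congr rfl fun k _ => ?_
  rw [Complex.cpow_sub _ _ hx0, Complex.cpow_natCast]
  have hp : (x : ℂ) ^ (((m : ℂ) + 2) / 2) ≠ 0 := by simp [Complex.cpow_eq_zero_iff, hx0]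
  field_simp

theorem tendsto_cpow_mul_exp_neg_S {m : ℕ} (a : Fin m → ℂ) (z : ℂ) : Filter.Tendsto
    (fun x : ℝ => ‖(x : ℂ) ^ z * Complex.exp (-S (x : ℂ) a)‖) Filter.atTop (nhds 0) := by
  set p : ℝ := ((m : ℝ) + 2) / 2 with hp
  have hp1 : 1 ≤ p := by rw [hp]; linarith [(Nat.cast_nonneg m : (0 : ℝ) ≤ m)]
  have hre : Filter.Tendsto (fun x : ℝ => (S (x : ℂ) a / ((x : ℂ) ^ (((m : ℂ) + 2) / 2))).re)
      Filter.atTop (nhds (2 / ((m : ℝ) + 2))) := by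
    have := (Complex.continuous_re.tendsto _).comp (tendsto_S_div a)
    rwa [show (2 / ((m : ℂ) + 2)).re = 2 / ((m : ℝ) + 2) by
      rw [show 2 / ((m : ℂ) + 2) = ((2 / ((m : ℝ) + 2) : ℝ) : ℂ) by push_cast; ring,
        Complex.ofReal_re]] at this
  set c : ℝ := 1 / ((m : ℝ) + 2) with hc
  have hc0 : 0 < c := by positivity
  have hev := hre.eventually (lt_mem_nhds (show c < 2 / ((m : ℝ) + 2) by
    rw [hc]; gcongr; norm_num))
  have hlim : Filter.Tendsto (fun x : ℝ => x ^ z.re * Real.exp (-c * x)) Filter.atTop (nhds 0) :=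
    tendsto_rpow_mul_exp_neg_mul_atTop_nhds_zero _ _ hc0
  refine squeeze_zero' (Filter.Eventually.of_forall fun _ => norm_nonneg _) ?_ hlim
  filter_upwards [hev, Filter.eventually_ge_atTop 1] with x hx hx1
  have hx0 : 0 < x := by linarith
  rw [norm_mul, Complex.norm_cpow_eq_rpow_re_of_pos hx0, Complex.norm_exp]
  have h1 : (x : ℂ) ^ (((m : ℂ) + 2) / 2) = ((x ^ p : ℝ) : ℂ) := by
    rw [Complex.ofReal_cpow hx0.le]; congr 1; rw [hp]; push_cast; ring
  rw [h1, Complex.div_ofReal_re, lt_div_iff₀ (by positivity)] at hx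
  have h2 : x ≤ x ^ p := by
    simpa using Real.rpow_le_rpow_of_exponent_le hx1 hp1
  gcongr
  rw [Complex.neg_re]
  nlinarith

/-- The defining properties determine the canonical solution: there is at most one. -/
theorem IsCanonicalSolution.unique {m : ℕ} {Φ Ψ : ℂ → (Fin m → ℂ) → ℂ}
    (hΦ : IsCanonicalSolution m Φ) (hΨ : IsCanonicalSolution m Ψ) : Φ = Ψ := by
  -- asymptotics on the positive real axis
  have lim : ∀ {F : ℂ → (Fin m → ℂ) → ℂ}, IsCanonicalSolution m F → ∀ a,
      Filter.Tendsto (fun x : ℝ => F x a / ((x : ℂ) ^ r a * Complex.exp (-S x a)))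
        Filter.atTop (nhds 1) ∧
      Filter.Tendsto (fun x : ℝ => deriv (fun Y => F Y a) x /
        ((x : ℂ) ^ ((m : ℂ) / 2 + r a) * Complex.exp (-S x a))) Filter.atTop (nhds (-1)) := by
    intro F hF a
    have hθ : (0 : ℝ) < 3 * Real.pi / (m + 2) := by positivity
    have hz : ∀ M : ℝ, Filter.Tendsto (fun x : ℝ => M * ‖(x : ℂ)‖ ^ (-(1 / 2) : ℝ))
        Filter.atTop (nhds 0) := by
      intro M
      have h := (tendsto_rpow_neg_atTop (show (0 : ℝ) < 1 / 2 by norm_num)).const_mul M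
      rw [mul_zero] at h
      refine h.congr' ?_
      filter_upwards [Filter.eventually_ge_atTop 0] with x hx
      rw [Complex.norm_real, Real.norm_of_nonneg hx]
    obtain ⟨M, R, _, h1⟩ := hF.asymp {a} isCompact_singleton 0 hθ
    obtain ⟨M', R', _, h2⟩ := hF.asymp_deriv {a} isCompact_singleton 0 hθ
    constructor
    · rw [tendsto_iff_norm_sub_tendsto_zero]
      refine squeeze_zero' (Filter.Eventually.of_forall fun _ => norm_nonneg _) ?_ (hz M)
      filter_upwards [Filter.eventually_ge_atTop 0, Filter.eventually_ge_atTop R] with x hx hR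
      exact h1 a rfl x (by rwa [Complex.norm_real, Real.norm_of_nonneg hx])
        (by rw [Complex.arg_ofReal_of_nonneg hx, abs_zero])
    · rw [tendsto_iff_norm_sub_tendsto_zero]
      refine squeeze_zero' (Filter.Eventually.of_forall fun _ => norm_nonneg _) ?_ (hz M')
      filter_upwards [Filter.eventually_ge_atTop 0, Filter.eventually_ge_atTop R'] with x hx hR
      exact h2 a rfl x (by rwa [Complex.norm_real, Real.norm_of_nonneg hx])
        (by rw [Complex.arg_ofReal_of_nonneg hx, abs_zero])
  have diff : ∀ {F : ℂ → (Fin m → ℂ) → ℂ}, IsCanonicalSolution m F → ∀ a,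
      Differentiable ℂ (fun Y => F Y a) := fun hF a =>
    hF.entire.comp (differentiable_id.prodMk (differentiable_const a))
  suffices H : ∀ a, (fun Y => Φ Y a) = fun Y => Ψ Y a by
    funext X a; exact congrFun (H a) X
  intro a
  obtain ⟨f1, f2⟩ := lim hΦ a
  obtain ⟨g1, g2⟩ := lim hΨ a
  have df := diff hΦ a
  have dg := diff hΨ a
  have of := hΦ.ode a
  have og := hΨ.ode a
  change ∀ X, -deriv (deriv (fun Y => Φ Y a)) X + W a X * (fun Y => Φ Y a) X = 0 at of
  change ∀ X, -deriv (deriv (fun Y => Ψ Y a)) X + W a X * (fun Y => Ψ Y a) X = 0 at og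
  change Filter.Tendsto (fun x : ℝ => (fun Y => Φ Y a) x / _) _ _ at f1
  change Filter.Tendsto (fun x : ℝ => (fun Y => Ψ Y a) x / _) _ _ at g1
  generalize (fun Y => Φ Y a) = f at *
  generalize (fun Y => Ψ Y a) = g at *
  have df' : Differentiable ℂ (deriv f) := df.deriv
  have dg' : Differentiable ℂ (deriv g) := dg.deriv
  -- the Wronskian is constant and tends to zero, hence vanishes
  have hw : ∀ X, f X * deriv g X - deriv f X * g X = f 0 * deriv g 0 - deriv f 0 * g 0 := by
    intro X
    refine is_const_of_deriv_eq_zero (𝕜 := ℂ) (f := fun X => f X * deriv g X - deriv f X * g X)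
      (by fun_prop) (fun Y => ?_) X 0
    have := ((df Y).hasDerivAt.mul (dg' Y).hasDerivAt).sub
      ((df' Y).hasDerivAt.mul (dg Y).hasDerivAt)
    refine this.deriv.trans ?_
    linear_combination (-f Y) * og Y + g Y * of Y
  have hx0 : ∀ᶠ x : ℝ in Filter.atTop, (x : ℂ) ≠ 0 := by
    filter_upwards [Filter.eventually_gt_atTop 0] with x hx
    exact_mod_cast hx.ne'
  have w0 : ∀ X, f X * deriv g X - deriv f X * g X = 0 := by
    intro X
    rw [hw X]
    have d1 : Filter.Tendsto (fun x : ℝ => (x : ℂ) ^ r a * Complex.exp (-S x a))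
        Filter.atTop (nhds 0) := tendsto_zero_iff_norm_tendsto_zero.2 (tendsto_cpow_mul_exp_neg_S a _)
    have d2 : Filter.Tendsto (fun x : ℝ => (x : ℂ) ^ ((m : ℂ) / 2 + r a) * Complex.exp (-S x a))
        Filter.atTop (nhds 0) := tendsto_zero_iff_norm_tendsto_zero.2 (tendsto_cpow_mul_exp_neg_S a _)
    have key := ((f1.mul d1).mul (g2.mul d2)).sub ((f2.mul d2).mul (g1.mul d1))
    simp only [mul_zero, sub_zero] at key
    refine tendsto_nhds_unique (tendsto_const_nhds.congr' ?_) key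
    filter_upwards [hx0] with x hx
    rw [← hw x]
    have n1 : ∀ z : ℂ, (x : ℂ) ^ z ≠ 0 := fun z => by simp [Complex.cpow_eq_zero_iff, hx]
    have n2 := Complex.exp_ne_zero (-S (x : ℂ) a)
    rw [div_mul_cancel₀ _ (mul_ne_zero (n1 _) n2), div_mul_cancel₀ _ (mul_ne_zero (n1 _) n2),
      div_mul_cancel₀ _ (mul_ne_zero (n1 _) n2), div_mul_cancel₀ _ (mul_ne_zero (n1 _) n2)]
  -- so the quotient is locally constant, and tends to one
  have hq : Filter.Tendsto (fun x : ℝ => f x / g x) Filter.atTop (nhds 1) := by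
    have := f1.div g1 one_ne_zero
    rw [div_one] at this
    refine this.congr' ?_
    filter_upwards [hx0] with x hx
    have n1 : (x : ℂ) ^ r a ≠ 0 := by simp [Complex.cpow_eq_zero_iff, hx]
    exact div_div_div_cancel_right₀ (mul_ne_zero n1 (Complex.exp_ne_zero _)) _ _
  have hg : ∀ᶠ x : ℝ in Filter.atTop, g x ≠ 0 := by
    filter_upwards [g1.eventually_ne one_ne_zero] with x hx h
    exact hx (by rw [h, zero_div])
  obtain ⟨x₀, h₀⟩ := hg.exists
  set c : ℂ := f x₀ / g x₀ with hc
  -- `f = c g` near `x₀`, hence everywhere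
  have hfc : f = fun X => c * g X := by
    have han : AnalyticOnNhd ℂ f Set.univ := df.differentiableOn.analyticOnNhd isOpen_univ
    have hag : AnalyticOnNhd ℂ (fun X => c * g X) Set.univ :=
      (dg.const_mul c).differentiableOn.analyticOnNhd isOpen_univ
    refine han.eq_of_eventuallyEq hag (z₀ := (x₀ : ℂ)) ?_
    obtain ⟨ε, hε, hb⟩ := Metric.eventually_nhds_iff_ball.1
      (dg.continuous.continuousAt.eventually_ne h₀)
    filter_upwards [Metric.ball_mem_nhds (x₀ : ℂ) hε] with X hX
    have hquot : f X / g X = f x₀ / g x₀ := by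
      refine (convex_ball (x₀ : ℂ) ε).is_const_of_fderivWithin_eq_zero (𝕜 := ℂ)
        (f := fun X => f X / g X) ?_ ?_ hX (Metric.mem_ball_self hε)
      · exact fun Y hY => ((df Y).div (dg Y) (hb Y hY)).differentiableWithinAt
      · intro Y hY
        have hd : HasDerivAt (fun X => f X / g X) 0 Y := by
          have := (df Y).hasDerivAt.div (dg Y).hasDerivAt (hb Y hY)
          rwa [show deriv f Y * g Y - f Y * deriv g Y = 0 by linear_combination -(w0 Y),
            zero_div] at this
        rw [fderivWithin_of_isOpen Metric.isOpen_ball hY, hd.hasFDerivAt.fderiv]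
        ext; simp
    rw [hc, ← hquot, div_mul_cancel₀ _ (hb X hX)]
  have hc1 : c = 1 := by
    refine tendsto_nhds_unique (tendsto_const_nhds.congr' ?_) hq
    filter_upwards [hg] with x hx
    rw [hfc]
    exact (mul_div_cancel_right₀ _ hx).symm
  rw [hfc, hc1]; simp

/-- `ω = e^(2πi/(m+2))`. Its complex powers `ω ^ z` are `e^(2πiz/(m+2))`. -/
def omega (m : ℕ) : ℂ := Complex.exp (2 * Real.pi * Complex.I / ((m : ℂ) + 2))

theorem omega_cpow (m : ℕ) (z : ℂ) :
    omega m ^ z = Complex.exp (2 * Real.pi * Complex.I / ((m : ℂ) + 2) * z) := by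
  have hpos : (0 : ℝ) < (m : ℝ) + 2 := by positivity
  have hlog : Complex.log (omega m) = 2 * Real.pi * Complex.I / ((m : ℂ) + 2) := by
    have him : (2 * Real.pi * Complex.I / ((m : ℂ) + 2)).im = 2 * Real.pi / ((m : ℝ) + 2) := by
      rw [show 2 * (Real.pi : ℂ) * Complex.I / ((m : ℂ) + 2)
        = ((2 * Real.pi / ((m : ℝ) + 2) : ℝ) : ℂ) * Complex.I by push_cast; ring]
      rw [Complex.mul_I_im, Complex.ofReal_re]
    unfold omega
    apply Complex.log_exp
    · rw [him]
      have : 0 < 2 * Real.pi / ((m : ℝ) + 2) := by positivity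
      linarith [Real.pi_pos]
    · rw [him, div_le_iff₀ hpos]
      nlinarith [Real.pi_pos, (Nat.cast_nonneg m : (0 : ℝ) ≤ m)]
  have h0 : omega m ≠ 0 := Complex.exp_ne_zero _
  rw [Complex.cpow_def_of_ne_zero h0, hlog]

/-- `ω_k(a) = (ω^k a₁, ω^(2k) a₂, …, ω^(mk) a_m)`. -/
def rot {m : ℕ} (k : ℤ) (a : Fin m → ℂ) : Fin m → ℂ :=
  fun j => omega m ^ (k * ((j : ℤ) + 1)) * a j

/-- The renormalised solution `Φ₁(X, a) = ω^(-m/2 - r_m(a)) Φ₀(ω⁻¹ X, ω_(-1)(a))`. -/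
def PhiOne {m : ℕ} (Φ₀ : ℂ → (Fin m → ℂ) → ℂ) (X : ℂ) (a : Fin m → ℂ) : ℂ :=
  omega m ^ (-(m : ℂ) / 2 - r a) * Φ₀ ((omega m)⁻¹ * X) (rot (-1) a)

/-- The renormalised solution `Φ₋₁(X, a) = ω^(m/2 + r_m(a)) Φ₀(ω X, ω_1(a))`. -/
def PhiNegOne {m : ℕ} (Φ₀ : ℂ → (Fin m → ℂ) → ℂ) (X : ℂ) (a : Fin m → ℂ) : ℂ :=
  omega m ^ ((m : ℂ) / 2 + r a) * Φ₀ (omega m * X) (rot 1 a)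

/-- `C` is the (normalised) Stokes multiplier of `Φ₋₁` with respect to `Φ₀`:
`Φ₋₁ = C(a) Φ₀ + Φ₁`. -/
def IsStokesMultiplier {m : ℕ} (Φ₀ : ℂ → (Fin m → ℂ) → ℂ) (C : (Fin m → ℂ) → ℂ) : Prop :=
  ∀ (a : Fin m → ℂ) (X : ℂ), PhiNegOne Φ₀ X a = C a * Φ₀ X a + PhiOne Φ₀ X a

end StokesODE

end

noncomputable section

namespace StokesODE

/-! Two facts carry the proof. First, the equation, the growth data `r` and `S`, and the sectors are
all compatible with complex conjugation. So `conj Φ₀(conj X, conj a)` is again canonical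
(`IsCanonicalSolution.conj`), and by uniqueness it is `Φ₀` itself. As conjugation inverts ω, it
exchanges Φ₁ and Φ₋₁ (`conj_phiOne`).

Second, the Wronskian of Φ₀ and Φ₁ is constant, and its limit along the ray between their
subdominant sectors is 2 (`wronskian_phiOne`). Conjugation gives the same value for Φ₋₁. Hence Φ₋₁ -
Φ₁ has zero Wronskian with Φ₀ and is a multiple `C(a) Φ₀`. Conjugating this relation swaps Φ₁ and
Φ₋₁; adding it to the relation at `conj a` leaves `(conj C(a) + C(conj a)) Φ₀ = 0`, and Φ₀ is not
identically zero. -/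

/-! ### Scaling and conjugation of the coefficients and growth data -/

theorem sqrtCoeff_zero {m : ℕ} (a : Fin m → ℂ) : sqrtCoeff a 0 = 1 := by
  rw [sqrtCoeff]

theorem sqrtCoeff_succ {m : ℕ} (a : Fin m → ℂ) (k : ℕ) :
    sqrtCoeff a (k + 1) = ((if h : k < m then a ⟨k, h⟩ else 0)
      - ∑ i : Fin k, sqrtCoeff a ((i : ℕ) + 1) * sqrtCoeff a (k - (i : ℕ))) / 2 := by
  rw [sqrtCoeff]

/-- The weighted homogeneity of the coefficients `b_k`. -/
theorem sqrtCoeff_scale {m : ℕ} (c : ℂ) (a : Fin m → ℂ) (n : ℕ) :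
    sqrtCoeff (fun j => c ^ ((j : ℕ) + 1) * a j) n = c ^ n * sqrtCoeff a n := by
  induction n using Nat.strong_induction_on with
  | _ n ih =>
    rcases n with _ | k
    · simp [sqrtCoeff_zero]
    · have hsum : ∑ i : Fin k, sqrtCoeff (fun j => c ^ ((j : ℕ) + 1) * a j) ((i : ℕ) + 1)
            * sqrtCoeff (fun j => c ^ ((j : ℕ) + 1) * a j) (k - (i : ℕ))
          = c ^ (k + 1) * ∑ i : Fin k,
              sqrtCoeff a ((i : ℕ) + 1) * sqrtCoeff a (k - (i : ℕ)) := by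
        rw [Finset.mul_sum]
        refine Finset.sum_congr rfl fun i _ => ?_
        have hi := i.2
        rw [ih _ (by omega), ih _ (by omega),
          show k + 1 = ((i : ℕ) + 1) + (k - (i : ℕ)) by omega, pow_add]
        ring
      rw [sqrtCoeff_succ, sqrtCoeff_succ, hsum]
      split_ifs <;> ring

theorem sqrtCoeff_conj {m : ℕ} (a : Fin m → ℂ) (n : ℕ) :
    sqrtCoeff (fun j => conj (a j)) n = conj (sqrtCoeff a n) := by
  induction n using Nat.strong_induction_on with
  | _ n ih =>
    rcases n with _ | k
    · simp [sqrtCoeff_zero]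
    · have hsum : ∑ i : Fin k, sqrtCoeff (fun j => conj (a j)) ((i : ℕ) + 1)
            * sqrtCoeff (fun j => conj (a j)) (k - (i : ℕ))
          = conj (∑ i : Fin k, sqrtCoeff a ((i : ℕ) + 1) * sqrtCoeff a (k - (i : ℕ))) := by
        rw [map_sum]
        refine Finset.sum_congr rfl fun i _ => ?_
        have hi := i.2
        rw [ih _ (by omega), ih _ (by omega), map_mul]
      rw [sqrtCoeff_succ, sqrtCoeff_succ, hsum, map_div₀, map_sub]
      split_ifs <;> simp [map_ofNat]

theorem W_conj {m : ℕ} (a : Fin m → ℂ) (X : ℂ) :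
    W (fun j => conj (a j)) (conj X) = conj (W a X) := by
  simp [W]

theorem r_conj {m : ℕ} (a : Fin m → ℂ) : r (fun j => conj (a j)) = conj (r a) := by
  unfold r
  split_ifs <;> simp [sqrtCoeff_conj, map_ofNat]

theorem conj_cpow_of_arg_ne_pi {X : ℂ} (hX : X.arg ≠ Real.pi) (z : ℂ) :
    conj X ^ conj z = conj (X ^ z) := by
  rw [Complex.conj_cpow _ _ hX, Complex.conj_conj]

theorem S_conj_of_arg_ne_pi {m : ℕ} (a : Fin m → ℂ) {X : ℂ} (hX : X.arg ≠ Real.pi) :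
    S (conj X) (fun j => conj (a j)) = conj (S X a) := by
  unfold S
  rw [map_sum]
  refine Finset.sum_congr rfl fun k _ => ?_
  rw [map_div₀, map_mul, sqrtCoeff_conj, ← conj_cpow_of_arg_ne_pi hX]
  simp [map_ofNat]

/-- In degree zero the sectors may contain the negative axis, the branch cut of the powers.
Conjugation still works there because no fractional power occurs. -/
theorem S_degree_zero (X : ℂ) (a : Fin 0 → ℂ) : S X a = X := by
  have h : (Finset.range (0 + 2)).filter (fun k => 2 * k < 0 + 2) = {0} := by decide
  rw [S, h, Finset.sum_singleton, sqrtCoeff_zero]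
  simp

theorem r_degree_zero (a : Fin 0 → ℂ) : r a = 0 := by
  have h : sqrtCoeff a 1 = 0 := by
    rw [sqrtCoeff_succ]
    simp
  simp [r, h]

theorem abs_arg_conj (X : ℂ) : |(conj X).arg| = |X.arg| := by
  rw [Complex.arg_conj]
  split_ifs with h
  · rw [h]
  · rw [abs_neg]

/-- For `m ≥ 1` the sector bound `3π/(m+2)` is at most `π`, so only degree zero can meet the branch
cut. -/
theorem arg_ne_pi_or_degree_eq_zero {m : ℕ} {θ : ℝ} (hθ : θ < 3 * Real.pi / (m + 2)) {X : ℂ}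
    (hX : |X.arg| ≤ θ) : X.arg ≠ Real.pi ∨ m = 0 := by
  by_contra! h
  obtain ⟨h1, h2⟩ := h
  rw [h1, abs_of_pos Real.pi_pos] at hX
  have hm : (1 : ℝ) ≤ m := by exact_mod_cast Nat.one_le_iff_ne_zero.2 h2
  have h3 := hX.trans_lt hθ
  rw [lt_div_iff₀ (by positivity)] at h3
  nlinarith [Real.pi_pos]

theorem amplitude_conj {m : ℕ} (a : Fin m → ℂ) {X : ℂ} (hX : X.arg ≠ Real.pi ∨ m = 0) :
    conj X ^ r (fun j => conj (a j)) * Complex.exp (-S (conj X) (fun j => conj (a j)))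
      = conj (X ^ r a * Complex.exp (-S X a)) := by
  rcases hX with hX | rfl
  · rw [r_conj, conj_cpow_of_arg_ne_pi hX, S_conj_of_arg_ne_pi a hX, map_mul, ← Complex.exp_conj,
      map_neg]
  · simp [r_degree_zero, S_degree_zero, ← Complex.exp_conj]

theorem deriv_amplitude_conj {m : ℕ} (a : Fin m → ℂ) {X : ℂ} (hX : X.arg ≠ Real.pi ∨ m = 0) :
    conj X ^ ((m : ℂ) / 2 + r (fun j => conj (a j)))
        * Complex.exp (-S (conj X) (fun j => conj (a j)))
      = conj (X ^ ((m : ℂ) / 2 + r a) * Complex.exp (-S X a)) := by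
  rcases hX with hX | rfl
  · rw [r_conj, show (m : ℂ) / 2 + conj (r a) = conj ((m : ℂ) / 2 + r a) by simp [map_ofNat],
      conj_cpow_of_arg_ne_pi hX, S_conj_of_arg_ne_pi a hX, map_mul, ← Complex.exp_conj, map_neg]
  · simp [r_degree_zero, S_degree_zero, ← Complex.exp_conj]

/-! ### Conjugation symmetry of the canonical solution -/

theorem deriv_conj_conj_apply (f : ℂ → ℂ) (X : ℂ) :
    deriv (fun Y => conj (f (conj Y))) X = conj (deriv f (conj X)) := by
  have := congrFun (deriv_conj_conj (f := f)) X
  simpa [Function.comp_def] using this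

/-- Complex conjugation maps solutions of `f'' = W(·, a) f` to solutions of
`f'' = W(·, conj a) f`. -/
theorem ode_conj {m : ℕ} {a : Fin m → ℂ} {f : ℂ → ℂ}
    (hf : ∀ X, -deriv (deriv f) X + W a X * f X = 0) (X : ℂ) :
    -deriv (deriv fun Y => conj (f (conj Y))) X
      + W (fun j => conj (a j)) X * conj (f (conj X)) = 0 := by
  have h1 : deriv (fun Y => conj (f (conj Y))) = fun Y => conj (deriv f (conj Y)) :=
    funext fun Y => deriv_conj_conj_apply f Y
  have h2 := W_conj a (conj X)
  rw [Complex.conj_conj] at h2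
  rw [h1, deriv_conj_conj_apply, h2, ← map_mul, ← map_neg, ← map_add, hf, map_zero]

theorem continuous_conj_vector {m : ℕ} :
    Continuous fun (a : Fin m → ℂ) (j : Fin m) => conj (a j) :=
  continuous_pi fun j => Complex.continuous_conj.comp (continuous_apply j)

/-- Every defining condition is symmetric: conjugation preserves compactness, `‖X‖` and `|arg X|`,
and conjugates the comparison functions. -/
theorem IsCanonicalSolution.conj {m : ℕ} {Φ : ℂ → (Fin m → ℂ) → ℂ}
    (hΦ : IsCanonicalSolution m Φ) :
    IsCanonicalSolution m fun X a => conj (Φ (conj X) fun j => conj (a j)) where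
  -- Conjugating both argument and value preserves complex differentiability, also on the product
  -- space.
  entire p := by
    have := (hΦ.entire (star p)).star_star
    rwa [star_star] at this
  ode a X := by
    simpa using ode_conj (hΦ.ode fun j => starRingEnd ℂ (a j)) X
  asymp K hK θ hθ := by
    obtain ⟨M, R, hR, h⟩ := hΦ.asymp _ (hK.image continuous_conj_vector) θ hθ
    refine ⟨M, R, hR, fun a ha X hXR hXθ => ?_⟩
    have := h _ (Set.mem_image_of_mem _ ha) (starRingEnd ℂ X) (by rwa [Complex.norm_conj])
      (by rwa [abs_arg_conj])
    rw [amplitude_conj a (arg_ne_pi_or_degree_eq_zero hθ hXθ), Complex.norm_conj,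
      ← Complex.norm_conj] at this
    simpa using this
  asymp_deriv K hK θ hθ := by
    obtain ⟨M, R, hR, h⟩ := hΦ.asymp_deriv _ (hK.image continuous_conj_vector) θ hθ
    refine ⟨M, R, hR, fun a ha X hXR hXθ => ?_⟩
    have := h _ (Set.mem_image_of_mem _ ha) (starRingEnd ℂ X) (by rwa [Complex.norm_conj])
      (by rwa [abs_arg_conj])
    rw [deriv_amplitude_conj a (arg_ne_pi_or_degree_eq_zero hθ hXθ), Complex.norm_conj,
      ← Complex.norm_conj] at this
    rw [deriv_conj_conj_apply fun Y => Φ Y fun j => starRingEnd ℂ (a j)]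
    simpa using this

theorem IsCanonicalSolution.conj_apply {m : ℕ} {Φ : ℂ → (Fin m → ℂ) → ℂ}
    (hΦ : IsCanonicalSolution m Φ) (X : ℂ) (a : Fin m → ℂ) :
    starRingEnd ℂ (Φ X a) = Φ (starRingEnd ℂ X) fun j => starRingEnd ℂ (a j) := by
  have := congrFun (congrFun (hΦ.conj.unique hΦ) (starRingEnd ℂ X)) fun j => starRingEnd ℂ (a j)
  simpa using this

theorem conj_omega (m : ℕ) : conj (omega m) = (omega m)⁻¹ := by
  rw [omega, ← Complex.exp_conj, ← Complex.exp_neg]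
  congr 1
  simp [neg_div, map_ofNat]

theorem conj_omega_cpow (m : ℕ) (z : ℂ) : conj (omega m ^ z) = omega m ^ (-conj z) := by
  rw [omega_cpow, omega_cpow, ← Complex.exp_conj]
  congr 1
  simp [neg_div, map_ofNat]

theorem rot_neg_one {m : ℕ} (a : Fin m → ℂ) :
    rot (-1) a = fun j : Fin m => (omega m)⁻¹ ^ ((j : ℕ) + 1) * a j := by
  funext j
  rw [rot, inv_pow, ← zpow_natCast, ← zpow_neg]
  push_cast
  ring_nf

theorem conj_rot {m : ℕ} (k : ℤ) (a : Fin m → ℂ) :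
    (fun j => conj (rot k a j)) = rot (-k) fun j => conj (a j) := by
  funext j
  simp only [rot, map_mul, map_zpow₀, conj_omega, inv_zpow', neg_mul]

/-- Conjugation turns ω into its inverse, hence the rotation by ω⁻¹ into the rotation by ω; the
normalizing factors match as well. -/
theorem IsCanonicalSolution.conj_phiOne {m : ℕ} {Φ : ℂ → (Fin m → ℂ) → ℂ}
    (hΦ : IsCanonicalSolution m Φ) (X : ℂ) (a : Fin m → ℂ) :
    starRingEnd ℂ (PhiOne Φ X a)
      = PhiNegOne Φ (starRingEnd ℂ X) fun j => starRingEnd ℂ (a j) := by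
  rw [PhiOne, PhiNegOne, map_mul, hΦ.conj_apply, conj_omega_cpow, conj_rot, r_conj, map_mul,
    map_inv₀, conj_omega, inv_inv, neg_neg]
  congr 2
  simp [neg_div, map_ofNat]
  ring

/-! ### Wronskians of entire solutions -/

/-- The Wronskian `f g' - f' g`. -/
def wronskian (f g : ℂ → ℂ) (X : ℂ) : ℂ := f X * deriv g X - deriv f X * g X

theorem wronskian_eq_of_ode {V f g : ℂ → ℂ} (df : Differentiable ℂ f) (dg : Differentiable ℂ g)
    (hf : ∀ X, -deriv (deriv f) X + V X * f X = 0) (hg : ∀ X, -deriv (deriv g) X + V X * g X = 0)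
    (X Y : ℂ) : wronskian f g X = wronskian f g Y := by
  have df' : Differentiable ℂ (deriv f) := df.deriv
  have dg' : Differentiable ℂ (deriv g) := dg.deriv
  refine is_const_of_deriv_eq_zero (𝕜 := ℂ) (f := wronskian f g) ?_ (fun Z => ?_) X Y
  · exact (df.mul dg').sub (df'.mul dg)
  · have := ((df Z).hasDerivAt.mul (dg' Z).hasDerivAt).sub
      ((df' Z).hasDerivAt.mul (dg Z).hasDerivAt)
    refine this.deriv.trans ?_
    linear_combination (-f Z) * hg Z + g Z * hf Z

/-- Entire functions with vanishing Wronskian are proportional. -/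
theorem exists_eq_mul_of_wronskian_eq_zero {f g : ℂ → ℂ} (df : Differentiable ℂ f)
    (dg : Differentiable ℂ g) (hw : ∀ X, wronskian f g X = 0) {x₀ : ℂ} (h₀ : f x₀ ≠ 0) :
    ∃ c : ℂ, ∀ X, g X = c * f X := by
  refine ⟨g x₀ / f x₀, fun X => ?_⟩
  have hag : AnalyticOnNhd ℂ g Set.univ := dg.differentiableOn.analyticOnNhd isOpen_univ
  have haf : AnalyticOnNhd ℂ (fun X => g x₀ / f x₀ * f X) Set.univ :=
    (df.const_mul _).differentiableOn.analyticOnNhd isOpen_univ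
  -- The quotient `g / f` is constant only on a ball free of zeros of `f`; the identity theorem
  -- extends the proportionality to the plane.
  refine congrFun (hag.eq_of_eventuallyEq haf (z₀ := x₀) ?_) X
  obtain ⟨ε, hε, hb⟩ := Metric.eventually_nhds_iff_ball.1
    (df.continuous.continuousAt.eventually_ne h₀)
  filter_upwards [Metric.ball_mem_nhds x₀ hε] with Y hY
  have hquot : g Y / f Y = g x₀ / f x₀ := by
    refine Metric.isOpen_ball.is_const_of_deriv_eq_zero (convex_ball x₀ ε).isPreconnected
      (f := fun Z => g Z / f Z)
      (fun Z hZ => ((dg Z).div (df Z) (hb Z hZ)).differentiableWithinAt) (fun Z hZ => ?_) hY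
      (Metric.mem_ball_self hε)
    refine ((dg Z).hasDerivAt.div (df Z).hasDerivAt (hb Z hZ)).deriv.trans ?_
    have := hw Z
    rw [wronskian] at this
    rw [show deriv g Z * f Z - g Z * deriv f Z = 0 by linear_combination this, zero_div]
    rfl
  rw [← hquot, div_mul_cancel₀ _ (hb Y hY)]

/-! ### Rotation by ω⁻¹ of the equation and of the growth data -/

theorem exp_cpow_of_im_mem {L : ℂ} (h : L.im ∈ Set.Ioc (-Real.pi) Real.pi) (z : ℂ) :
    Complex.exp L ^ z = Complex.exp (L * z) := by
  rw [Complex.cpow_def_of_ne_zero (Complex.exp_ne_zero _), Complex.log_exp h.1 h.2]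

theorem IsCanonicalSolution.differentiable {m : ℕ} {Φ : ℂ → (Fin m → ℂ) → ℂ}
    (hΦ : IsCanonicalSolution m Φ) (a : Fin m → ℂ) : Differentiable ℂ fun Y => Φ Y a :=
  hΦ.entire.comp (differentiable_id.prodMk (differentiable_const a))

theorem deriv_phiOne {m : ℕ} (Φ : ℂ → (Fin m → ℂ) → ℂ) (a : Fin m → ℂ) :
    deriv (fun Y => PhiOne Φ Y a) = fun X => omega m ^ (-(m : ℂ) / 2 - r a) * (omega m)⁻¹
      * deriv (fun Y => Φ Y (rot (-1) a)) ((omega m)⁻¹ * X) := by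
  funext X
  unfold PhiOne
  rw [deriv_const_mul_field, deriv_comp_mul_left (omega m)⁻¹ (fun Y => Φ Y (rot (-1) a)),
    smul_eq_mul, mul_assoc]

theorem omega_pow (m : ℕ) : omega m ^ (m + 2) = 1 := by
  rw [omega, ← Complex.exp_nat_mul]
  have hm : (m : ℂ) + 2 ≠ 0 := by exact_mod_cast (by omega : m + 2 ≠ 0)
  push_cast
  rw [mul_div_cancel₀ _ hm, Complex.exp_two_pi_mul_I]

/-- `W` is homogeneous of degree `m` when `a_j` has weight `j`. The two derivatives supply the
remaining factor, and `ω^(m+2) = 1`, so Φ₁ solves the same equation as Φ₀. -/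
theorem W_rot_neg_one {m : ℕ} (a : Fin m → ℂ) (X : ℂ) :
    (omega m)⁻¹ ^ 2 * W (rot (-1) a) ((omega m)⁻¹ * X) = W a X := by
  have h : (omega m)⁻¹ ^ (m + 2) = 1 := by rw [inv_pow, omega_pow, inv_one]
  have key : (omega m)⁻¹ ^ 2 * (omega m)⁻¹ ^ m = 1 := by rw [← pow_add, add_comm, h]
  rw [W, W, rot_neg_one, mul_add, mul_pow, ← mul_assoc, key, one_mul, Finset.mul_sum]
  congr 1
  refine Finset.sum_congr rfl fun j _ => ?_
  have hj : (omega m)⁻¹ ^ ((j : ℕ) + 1) * (omega m)⁻¹ ^ (m - 1 - (j : ℕ)) = (omega m)⁻¹ ^ m := by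
    rw [← pow_add]
    congr 1
    omega
  rw [mul_pow]
  linear_combination ((omega m)⁻¹ ^ 2 * a j * X ^ (m - 1 - (j : ℕ))) * hj
    + a j * X ^ (m - 1 - (j : ℕ)) * key

theorem IsCanonicalSolution.phiOne_ode {m : ℕ} {Φ : ℂ → (Fin m → ℂ) → ℂ}
    (hΦ : IsCanonicalSolution m Φ) (a : Fin m → ℂ) (X : ℂ) :
    -deriv (deriv fun Y => PhiOne Φ Y a) X + W a X * PhiOne Φ X a = 0 := by
  rw [deriv_phiOne, deriv_const_mul_field,
    deriv_comp_mul_left (omega m)⁻¹ (deriv fun Y => Φ Y (rot (-1) a)), smul_eq_mul, PhiOne,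
    ← W_rot_neg_one]
  linear_combination (omega m ^ (-(m : ℂ) / 2 - r a) * (omega m)⁻¹ ^ 2)
    * hΦ.ode (rot (-1) a) ((omega m)⁻¹ * X)

theorem IsCanonicalSolution.differentiable_phiOne {m : ℕ} {Φ : ℂ → (Fin m → ℂ) → ℂ}
    (hΦ : IsCanonicalSolution m Φ) (a : Fin m → ℂ) :
    Differentiable ℂ fun Y => PhiOne Φ Y a :=
  ((hΦ.differentiable (rot (-1) a)).comp (differentiable_id.const_mul _)).const_mul _

/-- The logarithm of `ω`. -/
def logOmega (m : ℕ) : ℂ := 2 * Real.pi * Complex.I / ((m : ℂ) + 2)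

theorem logOmega_mul (m : ℕ) : logOmega m * (((m : ℂ) + 2) / 2) = Real.pi * Complex.I := by
  have hm : (m : ℂ) + 2 ≠ 0 := by exact_mod_cast (by omega : m + 2 ≠ 0)
  rw [logOmega]
  field_simp

theorem logOmega_half_im (m : ℕ) : (logOmega m / 2).im = Real.pi / (m + 2) := by
  rw [show logOmega m / 2 = ((Real.pi / (m + 2) : ℝ) : ℂ) * Complex.I by
    rw [logOmega]; push_cast; ring, Complex.im_ofReal_mul]
  simp

theorem logOmega_half_re (m : ℕ) : (logOmega m / 2).re = 0 := by
  rw [show logOmega m / 2 = ((Real.pi / (m + 2) : ℝ) : ℂ) * Complex.I by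
    rw [logOmega]; push_cast; ring, Complex.re_ofReal_mul]
  simp

theorem inv_omega_pow (m k : ℕ) : (omega m)⁻¹ ^ k = Complex.exp (-(k * logOmega m)) := by
  rw [omega, ← Complex.exp_neg, ← Complex.exp_nat_mul, logOmega]
  ring_nf

/-- For even `m` the coefficient `b_(1+m/2)` has weight `(m+2)/2`, half the order of ω, so the
rotation changes its sign. -/
theorem r_rot_neg_one {m : ℕ} (a : Fin m → ℂ) : r (rot (-1) a) = -(m : ℂ) / 2 - r a := by
  unfold r
  split_ifs with h
  · obtain ⟨n, rfl⟩ := h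
    have h2 : (n + n) / 2 = n := by omega
    have h3 : (omega (n + n))⁻¹ ^ (1 + n) = -1 := by
      have := logOmega_mul (n + n)
      push_cast at this
      rw [inv_omega_pow, show -(((1 + n : ℕ) : ℂ) * logOmega (n + n)) = -(Real.pi * Complex.I) by
        push_cast; linear_combination -this, Complex.exp_neg, Complex.exp_pi_mul_I]
      norm_num
    rw [rot_neg_one, sqrtCoeff_scale, h2, h3]
    ring
  · ring

/-- The rotation by `ω⁻¹` changes the sign of the exponent `S`. -/
theorem S_rot_neg_one {m : ℕ} (a : Fin m → ℂ) {L : ℂ}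
    (h : L.im ∈ Set.Ioc (-Real.pi) Real.pi)
    (h' : (L - logOmega m).im ∈ Set.Ioc (-Real.pi) Real.pi) :
    S (Complex.exp (L - logOmega m)) (rot (-1) a) = -S (Complex.exp L) a := by
  unfold S
  rw [← Finset.sum_neg_distrib]
  refine Finset.sum_congr rfl fun k _ => ?_
  rw [exp_cpow_of_im_mem h, exp_cpow_of_im_mem h', rot_neg_one, sqrtCoeff_scale, inv_omega_pow]
  -- The weight of `b_k` cancels the rotation of `X^(-k)`, leaving `ω^(-(m+2)/2) = -1` for every
  -- `k`. Both logarithms must be principal.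
  have key : Complex.exp (-(k * logOmega m))
      * Complex.exp ((L - logOmega m) * (((m : ℂ) + 2) / 2 - k))
      = -Complex.exp (L * (((m : ℂ) + 2) / 2 - k)) := by
    rw [← Complex.exp_add, show -(k * logOmega m) + (L - logOmega m) * (((m : ℂ) + 2) / 2 - k)
      = L * (((m : ℂ) + 2) / 2 - k) - Real.pi * Complex.I by
        linear_combination -logOmega_mul m, Complex.exp_sub, Complex.exp_pi_mul_I]
    ring
  linear_combination (sqrtCoeff a k / (((m : ℂ) + 2) / 2 - k)) * key

/-! ### The Wronskians of Φ₀ with Φ₁ and Φ₋₁ -/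

/-- With `X = exp (s + φ)` and `φ` purely imaginary, the principal logarithm is explicit, so powers
of `X` become exponentials. -/
theorem IsCanonicalSolution.tendsto_ray {m : ℕ} {Φ : ℂ → (Fin m → ℂ) → ℂ}
    (hΦ : IsCanonicalSolution m Φ) (a : Fin m → ℂ) {φ : ℂ} (hre : φ.re = 0)
    (hpi : φ.im ∈ Set.Ioc (-Real.pi) Real.pi) (him : |φ.im| < 3 * Real.pi / (m + 2)) :
    Filter.Tendsto (fun s : ℝ => Φ (Complex.exp (s + φ)) a /
        (Complex.exp (s + φ) ^ r a * Complex.exp (-S (Complex.exp (s + φ)) a)))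
      Filter.atTop (nhds 1) ∧
    Filter.Tendsto (fun s : ℝ => deriv (fun Y => Φ Y a) (Complex.exp (s + φ)) /
        (Complex.exp (s + φ) ^ ((m : ℂ) / 2 + r a) * Complex.exp (-S (Complex.exp (s + φ)) a)))
      Filter.atTop (nhds (-1)) := by
  have hnorm : ∀ s : ℝ, ‖Complex.exp (s + φ)‖ = Real.exp s := fun s => by
    simp [Complex.norm_exp, hre]
  have harg : ∀ s : ℝ, (Complex.exp (s + φ)).arg = φ.im := fun s => by
    rw [← Complex.log_im, Complex.log_exp] <;> simp [hpi.1, hpi.2]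
  have hz : ∀ M : ℝ, Filter.Tendsto
      (fun s : ℝ => M * ‖Complex.exp (s + φ)‖ ^ (-(1 / 2) : ℝ)) Filter.atTop (nhds 0) := by
    intro M
    have h := ((tendsto_rpow_neg_atTop (show (0 : ℝ) < 1 / 2 by norm_num)).comp
      Real.tendsto_exp_atTop).const_mul M
    rw [mul_zero] at h
    simpa only [hnorm, Function.comp_def] using h
  obtain ⟨M, R, _, h1⟩ := hΦ.asymp {a} isCompact_singleton _ him
  obtain ⟨M', R', _, h2⟩ := hΦ.asymp_deriv {a} isCompact_singleton _ him
  constructor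
  · rw [tendsto_iff_norm_sub_tendsto_zero]
    refine squeeze_zero' (Filter.Eventually.of_forall fun _ => norm_nonneg _) ?_ (hz M)
    filter_upwards [Real.tendsto_exp_atTop.eventually_ge_atTop R] with s hs
    exact h1 a rfl _ (by rwa [hnorm]) (by rw [harg])
  · rw [tendsto_iff_norm_sub_tendsto_zero]
    refine squeeze_zero' (Filter.Eventually.of_forall fun _ => norm_nonneg _) ?_ (hz M')
    filter_upwards [Real.tendsto_exp_atTop.eventually_ge_atTop R'] with s hs
    exact h2 a rfl _ (by rwa [hnorm]) (by rw [harg])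

/-- The Wronskian of `Φ₀` and `Φ₁` is `2`; it is evaluated along the ray bisecting the two
sectors in which they are subdominant. -/
theorem IsCanonicalSolution.wronskian_phiOne {m : ℕ} {Φ : ℂ → (Fin m → ℂ) → ℂ}
    (hΦ : IsCanonicalSolution m Φ) (a : Fin m → ℂ) (X : ℂ) :
    wronskian (fun Y => Φ Y a) (fun Y => PhiOne Φ Y a) X = 2 := by
  have hpos : (0 : ℝ) < Real.pi / (m + 2) := by positivity
  have hlt : Real.pi / (m + 2) < Real.pi := by
    rw [div_lt_iff₀ (by positivity)]
    nlinarith [Real.pi_pos, (Nat.cast_nonneg m : (0 : ℝ) ≤ m)]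
  have hsector : Real.pi / (m + 2) < 3 * Real.pi / (m + 2) := by
    gcongr
    linarith [Real.pi_pos]
  have him := logOmega_half_im m
  have hre := logOmega_half_re m
  have hneg : (-(logOmega m / 2)).im = -(Real.pi / (m + 2)) := by rw [Complex.neg_im, him]
  have hmem : (logOmega m / 2).im ∈ Set.Ioc (-Real.pi) Real.pi := by
    rw [him]; constructor <;> linarith
  have hmem' : (-(logOmega m / 2)).im ∈ Set.Ioc (-Real.pi) Real.pi := by
    rw [hneg]; constructor <;> linarith
  obtain ⟨f1, f2⟩ := hΦ.tendsto_ray a hre hmem (by rwa [him, abs_of_pos hpos])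
  obtain ⟨g1, g2⟩ := hΦ.tendsto_ray (rot (-1) a) (φ := -(logOmega m / 2)) (by simp [hre]) hmem'
    (by rwa [hneg, abs_neg, abs_of_pos hpos])
  -- The limit is `-(1 · (-1)) - (-1) · 1 = 2`. The points `X` and `ω⁻¹ X` have arguments
  -- `±π/(m+2)`, both inside the admissible sector.
  have key := (f1.mul g2).neg.sub (f2.mul g1)
  norm_num at key
  refine tendsto_nhds_unique (tendsto_const_nhds.congr fun s : ℝ => ?_) key
  have hL : ((s : ℂ) + logOmega m / 2).im ∈ Set.Ioc (-Real.pi) Real.pi := by simpa using hmem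
  have hL' : ((s : ℂ) + -(logOmega m / 2)).im ∈ Set.Ioc (-Real.pi) Real.pi := by
    simpa using hmem'
  have hsub : (s : ℂ) + -(logOmega m / 2) = s + logOmega m / 2 - logOmega m := by ring
  have hS := S_rot_neg_one a hL (hsub ▸ hL')
  have hX : (omega m)⁻¹ * Complex.exp (s + logOmega m / 2)
      = Complex.exp (s + -(logOmega m / 2)) := by
    rw [omega, ← logOmega, ← Complex.exp_neg, ← Complex.exp_add]
    ring_nf
  rw [wronskian_eq_of_ode (hΦ.differentiable a) (hΦ.differentiable_phiOne a) (hΦ.ode a)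
    (hΦ.phiOne_ode a) X (Complex.exp (s + logOmega m / 2)), wronskian, deriv_phiOne, PhiOne]
  beta_reduce
  rw [hX, exp_cpow_of_im_mem hL, exp_cpow_of_im_mem hL, exp_cpow_of_im_mem hL', exp_cpow_of_im_mem hL',
    r_rot_neg_one]
  rw [← hsub] at hS
  rw [hS, omega_cpow, ← logOmega]
  have hinv : (omega m)⁻¹ = Complex.exp (-logOmega m) := by
    rw [omega, ← logOmega, Complex.exp_neg]
  rw [hinv]
  set L : ℂ := s + logOmega m / 2 with hLdef
  set T := S (Complex.exp L) a
  set L' : ℂ := s + -(logOmega m / 2) with hLdef'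
  -- The factors `exp (∓T)` cancel, and the powers cancel the normalization of Φ₁ up to a sign: `-1`
  -- for `Φ₀ Φ₁'` here, `+1` for `Φ₀' Φ₁` in `e2`. So the Wronskian equals the normalized expression
  -- exactly, for every `s`.
  have e1 : Complex.exp (logOmega m * (-(m : ℂ) / 2 - r a)) * Complex.exp (-logOmega m)
      = -((Complex.exp (L * r a) * Complex.exp (-T))
        * (Complex.exp (L' * (m / 2 + (-(m : ℂ) / 2 - r a))) * Complex.exp (- -T)))⁻¹ := by
    rw [← Complex.exp_add, ← Complex.exp_add, ← Complex.exp_add, ← Complex.exp_add,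
      ← Complex.exp_neg, show logOmega m * (-(m : ℂ) / 2 - r a) + -logOmega m
        = -(L * r a + -T + (L' * (m / 2 + (-(m : ℂ) / 2 - r a)) + - -T)) - Real.pi * Complex.I by
      rw [hLdef, hLdef']; linear_combination -logOmega_mul m, Complex.exp_sub,
      Complex.exp_pi_mul_I]
    ring
  have e2 : Complex.exp (logOmega m * (-(m : ℂ) / 2 - r a))
      = ((Complex.exp (L * (m / 2 + r a)) * Complex.exp (-T))
        * (Complex.exp (L' * (-(m : ℂ) / 2 - r a)) * Complex.exp (- -T)))⁻¹ := by
    rw [← Complex.exp_add, ← Complex.exp_add, ← Complex.exp_add, ← Complex.exp_neg]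
    congr 1
    rw [hLdef, hLdef']
    ring
  rw [e1, e2]
  field_simp

/-- This form transfers results on Φ₁ to Φ₋₁ without a second asymptotic computation. -/
theorem IsCanonicalSolution.phiNegOne_eq {m : ℕ} {Φ : ℂ → (Fin m → ℂ) → ℂ}
    (hΦ : IsCanonicalSolution m Φ) (a : Fin m → ℂ) :
    (fun X => PhiNegOne Φ X a) = fun X =>
      starRingEnd ℂ (PhiOne Φ (starRingEnd ℂ X) fun j => starRingEnd ℂ (a j)) := by
  funext X
  simp [hΦ.conj_phiOne]

/-- The Wronskian of `Φ₀` and `Φ₋₁` is `2`, by complex conjugation. -/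
theorem IsCanonicalSolution.wronskian_phiNegOne {m : ℕ} {Φ : ℂ → (Fin m → ℂ) → ℂ}
    (hΦ : IsCanonicalSolution m Φ) (a : Fin m → ℂ) (X : ℂ) :
    wronskian (fun Y => Φ Y a) (fun Y => PhiNegOne Φ Y a) X = 2 := by
  have hf : (fun Y => Φ Y a) = fun Y =>
      starRingEnd ℂ (Φ (starRingEnd ℂ Y) fun j => starRingEnd ℂ (a j)) := by
    funext Y
    simp [hΦ.conj_apply]
  have h := congrArg (starRingEnd ℂ)
    (hΦ.wronskian_phiOne (fun j => starRingEnd ℂ (a j)) (starRingEnd ℂ X))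
  rw [wronskian, map_ofNat] at h
  rw [hf, hΦ.phiNegOne_eq, wronskian,
    deriv_conj_conj_apply fun Y => PhiOne Φ Y fun j => starRingEnd ℂ (a j),
    deriv_conj_conj_apply fun Y => Φ Y fun j => starRingEnd ℂ (a j)]
  simpa only [map_sub, map_mul] using h

theorem IsCanonicalSolution.differentiable_phiNegOne {m : ℕ} {Φ : ℂ → (Fin m → ℂ) → ℂ}
    (hΦ : IsCanonicalSolution m Φ) (a : Fin m → ℂ) :
    Differentiable ℂ fun Y => PhiNegOne Φ Y a :=
  ((hΦ.differentiable (rot 1 a)).comp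
    (differentiable_id.const_mul _)).const_mul _

/-! ### The Stokes multiplier and its symmetry -/

theorem IsCanonicalSolution.exists_ne_zero {m : ℕ} {Φ : ℂ → (Fin m → ℂ) → ℂ}
    (hΦ : IsCanonicalSolution m Φ) (a : Fin m → ℂ) : ∃ X, Φ X a ≠ 0 := by
  by_contra! h
  have := hΦ.wronskian_phiOne a 0
  simp [wronskian, h] at this

/-- Φ₁ and Φ₋₁ have the same Wronskian with Φ₀, so their difference is proportional to Φ₀. -/
theorem IsCanonicalSolution.exists_stokes {m : ℕ} {Φ : ℂ → (Fin m → ℂ) → ℂ}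
    (hΦ : IsCanonicalSolution m Φ) (a : Fin m → ℂ) :
    ∃ c : ℂ, ∀ X, PhiNegOne Φ X a = c * Φ X a + PhiOne Φ X a := by
  obtain ⟨x₀, h₀⟩ := hΦ.exists_ne_zero a
  have d1 := hΦ.differentiable_phiOne a
  have d2 := hΦ.differentiable_phiNegOne a
  obtain ⟨c, hc⟩ := exists_eq_mul_of_wronskian_eq_zero (hΦ.differentiable a) (d2.sub d1)
    (fun X => by
      have w1 := hΦ.wronskian_phiOne a X
      have w2 := hΦ.wronskian_phiNegOne a X
      rw [wronskian] at w1 w2 ⊢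
      rw [deriv_sub (d2 X) (d1 X), Pi.sub_apply]
      linear_combination w2 - w1) h₀
  refine ⟨c, fun X => ?_⟩
  have := hc X
  rw [Pi.sub_apply] at this
  linear_combination this

end StokesODE

end

theorem proposition1 (m : ℕ) (Φ₀ : ℂ → (Fin m → ℂ) → ℂ)
    (hΦ₀ : StokesODE.IsCanonicalSolution m Φ₀) :
    ∃ C : (Fin m → ℂ) → ℂ,
      (∀ C' : (Fin m → ℂ) → ℂ, StokesODE.IsStokesMultiplier Φ₀ C' ↔ C' = C) ∧
      (∀ a : Fin m → ℂ, conj (C a) + C (fun j => conj (a j)) = 0) ∧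
      ((fun (a : Fin m → ℂ) (j : Fin m) => conj (a j)) '' {a | C a = 0} = {a | C a = 0}) ∧
      (∀ a : Fin m → ℝ, (-Complex.I * C (fun j => (a j : ℂ))).im = 0) := by
  choose C hC using hΦ₀.exists_stokes
  have hconj : ∀ a : Fin m → ℂ, conj (C a) + C (fun j => conj (a j)) = 0 := by
    intro a
    obtain ⟨X, hX⟩ := hΦ₀.exists_ne_zero fun j => conj (a j)
    have h1 := congrArg conj (hC a (conj X))
    have h2 := hC (fun j => conj (a j)) X
    have h3 := congrFun (hΦ₀.phiNegOne_eq fun j => conj (a j)) X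
    simp only [Complex.conj_conj] at h3
    have h4 := congrFun (hΦ₀.phiNegOne_eq a) (conj X)
    simp only [Complex.conj_conj] at h4
    rw [h4, map_add, map_mul, hΦ₀.conj_apply, Complex.conj_conj, Complex.conj_conj, ← h3] at h1
    refine (mul_eq_zero.1 ?_).resolve_right hX
    -- After conjugation `h1` reads `Φ₁ = conj (C a) Φ₀ + Φ₋₁` at `(X, conj a)`; its sum with `h2`
    -- cancels Φ₁ and Φ₋₁.
    linear_combination -h1 - h2
  have hzero : ∀ a : Fin m → ℂ, C a = 0 → C (fun j => conj (a j)) = 0 := by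
    intro a ha
    simpa [ha] using hconj a
  refine ⟨C, fun C' => ⟨fun h => ?_, ?_⟩, hconj, ?_, fun a => ?_⟩
  · funext a
    obtain ⟨X, hX⟩ := hΦ₀.exists_ne_zero a
    refine mul_right_cancel₀ hX ?_
    linear_combination hC a X - h a X
  · rintro rfl
    exact hC
  · ext a
    constructor
    · rintro ⟨b, hb, rfl⟩
      exact hzero b hb
    · intro ha
      exact ⟨fun j => conj (a j), hzero a ha, by simp⟩
  -- A real vector is its own conjugate, so the relation says `2 Re C = 0`, and `Im(-iC) = -Re C`.
  · have h := congrArg Complex.re (hconj fun j => (a j : ℂ))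
    simp only [Complex.conj_ofReal, Complex.add_re, Complex.conj_re, Complex.zero_re] at h
    simp
    linarith
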